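/- For a matrix $A\in\mathbb C^{n\times n}$ and a function $g$ analytic on an open set containing the spectrum $\sigma(A)$, let $$g(A)=\frac1{2\pi i}\int_\Gamma g(\lambda)(\lambda\mathbf 1-A)^{-1}\,d\lambda ,$$ where the contour $\Gamma$ lies in the domain of $g$ and encloses $\sigma(A)$ (for example, small positively oriented circles around the eigenvalues). Let $f$ be analytic on an open disc of radius $R>0$ centered at $z_0\in\mathbb C$, and let $A\in\mathbb C^{n\times n}$ be a matrix whose spectrum $\sigma(A)$ is contained in this disc. Let $L,M\ge 0$ be integers, let $N=L+M+1$, and let $r=u/v$ be a Padé approximant of $f$ of degree $[L/M]$ at $z_0$; that is, $u$ and $v$ are complex polynomials with $\deg u\le L$, $\deg v\le M$, $v(z_0)\ne0$, and $$r^{(j)}(z_0)=f^{(j)}(z_0),\qquad j=0,1,\dots,L+M .$$ Assume that $v(\lambda)\neq0$ for all $\lambda\in\sigma(A)$. Then, for any norm $\lVert\cdot\rVert$ on the complex linear space $\mathbb C^{n\times n}$, the maximum below is attained and $$\bigl\lVert f(A)-r(A)\bigr\rVert\le\max_{t\in[0,1]}\Bigl\lVert (A-z_0\mathbf1)^N[v(A)]^{-1}\,\frac{(vf)^{(N)}\bigl((1-t)z_0\mathbf1+tA\bigr)}{N!}\Bigr\rVert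 .$$ -/

import Mathlib

open Filter Topology Polynomial

noncomputable section

/-- The contour integral `(1 / 2πi) ∫_Γ g(z) (z 1 - A)⁻¹ dz` (computed entrywise), where `Γ` is the
union of the positively oriented circles of radius `ε` centred at the eigenvalues of `A`. -/
def contourFunction {n : ℕ} (g : ℂ → ℂ) (A : Matrix (Fin n) (Fin n) ℂ) (ε : ℝ) :
    Matrix (Fin n) (Fin n) ℂ :=
  Matrix.of fun i j =>
    (2 * Real.pi * Complex.I)⁻¹ *
      ∑ μ ∈ A.finite_spectrum.toFinset, ∮ z in C(μ, ε), g z * (z • (1 : Matrix (Fin n) (Fin n) ℂ) - A)⁻¹ i j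

/-- The function `g` applied to the matrix `A`: the value of the contour integral above for all
sufficiently small radii `ε`. If `g` is analytic at every eigenvalue of `A`, the
integral does not depend on `ε` once `ε` is small (`contourFunction_eventually_eq`), and for small
`ε` the contour lies in the domain of analyticity of `g` and encloses the spectrum of `A`. -/
def matrixFunction {n : ℕ} (g : ℂ → ℂ) (A : Matrix (Fin n) (Fin n) ℂ) :
    Matrix (Fin n) (Fin n) ℂ :=
  limUnder (𝓝[>] (0 : ℝ)) (contourFunction g A)

/-- The rational function `u / v` is a Padé approximant of degree `[L/M]` of `f` at `z₀`:
it interpolates `f` at the single point `z₀` with multiplicity `L + M + 1`. -/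
structure IsPadeApproximant (f : ℂ → ℂ) (z₀ : ℂ) (L M : ℕ) (u v : ℂ[X]) : Prop where
  natDegree_num_le : u.natDegree ≤ L
  natDegree_den_le : v.natDegree ≤ M
  den_ne_zero : v.eval z₀ ≠ 0
  interpolates : ∀ j < L + M + 1,
    iteratedDeriv j (fun z => u.eval z / v.eval z) z₀ = iteratedDeriv j f z₀

lemma differentiableAt_inv_apply {n : ℕ} (A : Matrix (Fin n) (Fin n) ℂ) {z : ℂ}
    (hz : z ∉ spectrum ℂ A) (i j : Fin n) :
    DifferentiableAt ℂ (fun w : ℂ => (w • (1 : Matrix (Fin n) (Fin n) ℂ) - A)⁻¹ i j) z := by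
  have hdet : (z • (1 : Matrix (Fin n) (Fin n) ℂ) - A).det ≠ 0 := by
    rw [spectrum.notMem_iff, Algebra.algebraMap_eq_smul_one, Matrix.isUnit_iff_isUnit_det] at hz
    exact hz.ne_zero
  have hpoly : ∀ B : Matrix (Fin n) (Fin n) ℂ[X],
      Differentiable ℂ (fun w : ℂ => (B.map (Polynomial.eval w)).det) := by
    intro B
    have : (fun w : ℂ => (B.map (Polynomial.eval w)).det) = fun w => B.det.eval w := by
      funext w
      have := RingHom.map_det (Polynomial.evalRingHom w) B
      simpa [RingHom.mapMatrix_apply] using this.symm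
    rw [this]
    exact B.det.differentiable
  have hd : ∀ w : ℂ, (w • (1 : Matrix (Fin n) (Fin n) ℂ) - A)
      = A.charmatrix.map (Polynomial.eval w) := by
    intro w
    ext a b
    by_cases h : a = b
    · subst h; simp
    · simp [h]
  have hadj : Differentiable ℂ
      (fun w : ℂ => (w • (1 : Matrix (Fin n) (Fin n) ℂ) - A).adjugate i j) := by
    have : (fun w : ℂ => (w • (1 : Matrix (Fin n) (Fin n) ℂ) - A).adjugate i j)
        = fun w => (A.charmatrix.adjugate i j).eval w := by
      funext w
      rw [hd]
      have := RingHom.map_adjugate (Polynomial.evalRingHom w) A.charmatrix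
      have := congrFun (congrFun this i) j
      simpa [RingHom.mapMatrix_apply] using this.symm
    rw [this]
    exact (A.charmatrix.adjugate i j).differentiable
  have hD : Differentiable ℂ (fun w : ℂ => (w • (1 : Matrix (Fin n) (Fin n) ℂ) - A).det) := by
    simp_rw [hd]
    exact hpoly _
  have : (fun w : ℂ => (w • (1 : Matrix (Fin n) (Fin n) ℂ) - A)⁻¹ i j)
      = fun w => ((w • (1 : Matrix (Fin n) (Fin n) ℂ) - A).det)⁻¹ *
          (w • (1 : Matrix (Fin n) (Fin n) ℂ) - A).adjugate i j := by
    funext w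
    simp [Matrix.inv_def]
  rw [this]
  exact (hD.differentiableAt.inv hdet).mul hadj.differentiableAt

/-- Well-definedness of `matrixFunction`. -/
theorem contourFunction_eventually_eq {n : ℕ} (g : ℂ → ℂ) (A : Matrix (Fin n) (Fin n) ℂ)
    (hg : ∀ μ ∈ spectrum ℂ A, AnalyticAt ℂ g μ) :
    ∀ᶠ ε in 𝓝[>] (0 : ℝ), contourFunction g A ε = matrixFunction g A := by
  have hloc : ∀ μ ∈ A.finite_spectrum.toFinset, ∀ᶠ δ in 𝓝[>] (0 : ℝ),
      ∀ z ∈ Metric.closedBall μ δ, z ≠ μ → DifferentiableAt ℂ g z ∧ z ∉ spectrum ℂ A := by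
    intro μ hμ
    have h1 : ∀ᶠ z in 𝓝 μ, DifferentiableAt ℂ g z :=
      (hg μ (by simpa using hμ)).eventually_analyticAt.mono fun z hz => hz.differentiableAt
    have h2 : ∀ᶠ z in 𝓝 μ, z ≠ μ → z ∉ spectrum ℂ A := by
      have hc : IsClosed (spectrum ℂ A \ {μ}) := (A.finite_spectrum.subset Set.sdiff_subset).isClosed
      filter_upwards [hc.isOpen_compl.mem_nhds (x := μ) (by simp)] with z hz hzμ hzA
      exact hz ⟨hzA, hzμ⟩
    obtain ⟨r, hr, hball⟩ := Metric.eventually_nhds_iff_ball.1 (h1.and h2)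
    filter_upwards [Ioo_mem_nhdsGT hr] with δ hδ z hz hzμ
    have := hball z (Metric.closedBall_subset_ball hδ.2 hz)
    exact ⟨this.1, this.2 hzμ⟩
  have hall := (A.finite_spectrum.toFinset.eventually_all).2 hloc
  obtain ⟨δ, hδ, hδ0⟩ := (hall.and self_mem_nhdsWithin).exists
  have hδ0 : 0 < δ := hδ0
  have hconst : ∀ ε ∈ Set.Ioc 0 δ, contourFunction g A ε = contourFunction g A δ := by
    intro ε hε
    ext i j
    simp only [contourFunction, Matrix.of_apply]
    congr 1
    refine Finset.sum_congr rfl fun μ hμ => ?_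
    have hd : ∀ z ∈ Metric.closedBall μ δ \ Metric.ball μ ε, DifferentiableAt ℂ
        (fun z => g z * (z • (1 : Matrix (Fin n) (Fin n) ℂ) - A)⁻¹ i j) z := by
      intro z hz
      have hne : z ≠ μ := by
        rintro rfl
        exact hz.2 (Metric.mem_ball_self hε.1)
      have := hδ μ hμ z hz.1 hne
      exact this.1.mul (differentiableAt_inv_apply A this.2 i j)
    exact (Complex.circleIntegral_eq_of_differentiable_on_annulus_off_countable hε.1 hε.2
      Set.countable_empty (fun z hz => (hd z hz).continuousAt.continuousWithinAt)
      (fun z hz => hd z ⟨Metric.ball_subset_closedBall hz.1.1,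
        fun h => hz.1.2 (Metric.ball_subset_closedBall h)⟩)).symm
  have hev : ∀ᶠ ε in 𝓝[>] (0 : ℝ), contourFunction g A ε = contourFunction g A δ := by
    filter_upwards [Ioc_mem_nhdsGT hδ0] with ε hε using hconst ε hε
  have hlim : matrixFunction g A = contourFunction g A δ :=
    (tendsto_const_nhds.congr' (hev.mono fun _ h => h.symm)).limUnder_eq
  rw [hlim]
  exact hev

end

/-! Put G = vf − u, D = A − z₀ and B(t) = (1 − t)z₀ + tA. The Padé conditions make G vanish to order
N at z₀, and deg u < N gives G^(N) = (vf)^(N). The curves F_j(t) = v(A)⁻¹ D^j G^(j)(B(t)) satisfy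
F_j' = F_{j+1}, vanish at t = 0 for j < N, and F_0(1) = f(A) − r(A). Applying the mean value
inequality N times gives ‖F_0(1)‖ ≤ max ‖F_N‖ / N!, which is the claim.

The rules of calculus behind this are checked on generalized eigenvectors of A, which span. There
Cauchy's formula turns g(A) into the Taylor polynomial of g at μ in the nilpotent part A − μ
(`matrixFunction_mulVec_of_genEigenvector`), so each rule becomes an identity between Taylor
coefficients. The key one is `hasDerivAt_matrixFunction_segmentMatrix_mulVec`; the estimate is
`norm_le_pow_div_factorial_of_hasDerivAt`. -/

/-! ### Contour integrals on generalized eigenvectors. -/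

/-- On a generalized eigenvector the resolvent is a finite Laurent sum. -/
theorem resolvent_mulVec_eq_sum {n : ℕ} (A : Matrix (Fin n) (Fin n) ℂ) {μ z : ℂ} {K : ℕ}
    {w : Fin n → ℂ} (hw : ((A - μ • (1 : Matrix (Fin n) (Fin n) ℂ)) ^ K).mulVec w = 0)
    (hz : z ∉ spectrum ℂ A) (hzμ : z ≠ μ) :
    (z • (1 : Matrix (Fin n) (Fin n) ℂ) - A)⁻¹.mulVec w =
      ∑ k ∈ Finset.range K, (1 / (z - μ) ^ (k + 1)) •
        ((A - μ • (1 : Matrix (Fin n) (Fin n) ℂ)) ^ k).mulVec w := by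
  have hu : IsUnit (z • (1 : Matrix (Fin n) (Fin n) ℂ) - A) := by
    rwa [spectrum.notMem_iff, Algebra.algebraMap_eq_smul_one] at hz
  have hdet := (Matrix.isUnit_iff_isUnit_det _).1 hu
  have hne : z - μ ≠ 0 := sub_ne_zero.2 hzμ
  set D := A - μ • (1 : Matrix (Fin n) (Fin n) ℂ) with hD
  have hzA : z • (1 : Matrix (Fin n) (Fin n) ℂ) - A = (z - μ) • 1 - D := by
    rw [hD, sub_smul]; abel
  -- The product telescopes; the remainder vanishes at m = K.
  have hsum : ∀ m : ℕ, (z • (1 : Matrix (Fin n) (Fin n) ℂ) - A).mulVec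
      (∑ k ∈ Finset.range m, (1 / (z - μ) ^ (k + 1)) • (D ^ k).mulVec w) =
      w - (1 / (z - μ) ^ m) • (D ^ m).mulVec w := by
    intro m
    induction m with
    | zero => simp
    | succ m ih =>
      rw [Finset.sum_range_succ, Matrix.mulVec_add, ih, hzA, Matrix.mulVec_smul, Matrix.sub_mulVec,
        Matrix.smul_mulVec, Matrix.one_mulVec, Matrix.mulVec_mulVec, ← pow_succ', smul_sub,
        smul_smul]
      have : 1 / (z - μ) ^ (m + 1) * (z - μ) = 1 / (z - μ) ^ m := by
        field_simp
        ring
      rw [this]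
      abel
  have := hsum K
  rw [hw, smul_zero, sub_zero] at this
  conv_lhs => rw [← this]
  rw [Matrix.mulVec_mulVec, Matrix.nonsing_inv_mul _ hdet, Matrix.one_mulVec]

theorem contourFunction_mulVec_of_genEigenvector {n : ℕ} (g : ℂ → ℂ)
    (A : Matrix (Fin n) (Fin n) ℂ) {ε : ℝ} (hε : 0 < ε)
    (hg : ∀ ν ∈ spectrum ℂ A, ∀ z ∈ Metric.closedBall ν ε, DifferentiableAt ℂ g z)
    (hsep : ∀ ν ∈ spectrum ℂ A, ∀ z ∈ Metric.closedBall ν ε, z ≠ ν → z ∉ spectrum ℂ A)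
    {μ : ℂ} (hμ : μ ∈ spectrum ℂ A) {K : ℕ} {w : Fin n → ℂ}
    (hw : ((A - μ • (1 : Matrix (Fin n) (Fin n) ℂ)) ^ K).mulVec w = 0) :
    (contourFunction g A ε).mulVec w =
      ∑ k ∈ Finset.range K, (iteratedDeriv k g μ / k.factorial) •
        ((A - μ • (1 : Matrix (Fin n) (Fin n) ℂ)) ^ k).mulVec w := by
  have hne : ∀ {ν z : ℂ}, z ∈ Metric.sphere ν ε → z ≠ ν := by
    rintro ν z hz rfl
    simp [hε.ne] at hz
  ext i
  have hcont : ∀ ν ∈ spectrum ℂ A, ∀ j, CircleIntegrable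
      (fun z => g z * (z • (1 : Matrix (Fin n) (Fin n) ℂ) - A)⁻¹ i j) ν ε := by
    intro ν hν j
    refine ContinuousOn.circleIntegrable hε.le fun z hz => ?_
    have hz' := Metric.sphere_subset_closedBall hz
    exact ((hg ν hν z hz').mul (differentiableAt_inv_apply A (hsep ν hν z hz' (hne hz)) i j)
      ).continuousAt.continuousWithinAt
  -- Around μ this is Cauchy's formula for derivatives; around any other eigenvalue the integrand is
  -- holomorphic, the pole μ lying outside the disc.
  have hterm : ∀ ν ∈ spectrum ℂ A, ∀ k : ℕ,
      ∮ z in C(ν, ε), g z * (1 / (z - μ) ^ (k + 1)) =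
        if ν = μ then (2 * Real.pi * Complex.I / k.factorial) * iteratedDeriv k g μ else 0 := by
    intro ν hν k
    split_ifs with h
    · subst h
      have hd : DifferentiableOn ℂ g (Metric.closedBall ν ε) := fun z hz =>
        (hg ν hν z hz).differentiableWithinAt
      have := hd.circleIntegral_one_div_sub_center_pow_smul hε k
      simp only [smul_eq_mul] at this
      rw [← this]
      simp only [mul_comm]
    · have hd : ∀ z ∈ Metric.closedBall ν ε,
          DifferentiableAt ℂ (fun z => g z * (1 / (z - μ) ^ (k + 1))) z := by
        intro z hz
        have hzμ : z - μ ≠ 0 := by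
          rw [sub_ne_zero]
          rintro rfl
          exact hsep ν hν z hz (Ne.symm h) hμ
        refine (hg ν hν z hz).mul ((differentiableAt_const _).div ?_ (pow_ne_zero _ hzμ))
        fun_prop
      exact Complex.circleIntegral_eq_zero_of_differentiable_on_off_countable hε.le
        Set.countable_empty (fun z hz => (hd z hz).continuousAt.continuousWithinAt)
        (fun z hz => hd z (Metric.ball_subset_closedBall hz.1))
  have hcircle : ∀ ν ∈ spectrum ℂ A,
      ∑ j, (∮ z in C(ν, ε), g z * (z • (1 : Matrix (Fin n) (Fin n) ℂ) - A)⁻¹ i j) * w j =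
        ∑ k ∈ Finset.range K, (∮ z in C(ν, ε), g z * (1 / (z - μ) ^ (k + 1))) *
          ((A - μ • (1 : Matrix (Fin n) (Fin n) ℂ)) ^ k).mulVec w i := by
    intro ν hν
    have hmul : ∀ (h : ℂ → ℂ) (a : ℂ), (∮ z in C(ν, ε), h z) * a = ∮ z in C(ν, ε), h z * a := by
      intro h a
      simpa [smul_eq_mul] using (circleIntegral.integral_smul_const h a ν ε).symm
    simp only [hmul]
    rw [← circleIntegral.integral_fun_sum, ← circleIntegral.integral_fun_sum]
    · refine circleIntegral.integral_congr hε.le fun z hz => ?_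
      have hzA := hsep ν hν z (Metric.sphere_subset_closedBall hz) (hne hz)
      have hzμ : z ≠ μ := by rintro rfl; exact hzA hμ
      have := congrFun (resolvent_mulVec_eq_sum A hw hzA hzμ) i
      simp only [Matrix.mulVec, dotProduct, Finset.sum_apply, Pi.smul_apply, smul_eq_mul] at this ⊢
      simp only [mul_assoc, ← Finset.mul_sum]
      rw [this]
    · intro k hk
      refine ContinuousOn.circleIntegrable hε.le fun z hz => ?_
      have hz' := Metric.sphere_subset_closedBall hz
      have hzA := hsep ν hν z hz' (hne hz)
      have hzμ : z - μ ≠ 0 := by rw [sub_ne_zero]; rintro rfl; exact hzA hμ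
      have hd : DifferentiableAt ℂ (fun z => 1 / (z - μ) ^ (k + 1)) z :=
        (differentiableAt_const _).div (by fun_prop) (pow_ne_zero _ hzμ)
      exact (((hg ν hν z hz').mul hd).mul_const _).continuousAt.continuousWithinAt
    · intro j hj
      refine ContinuousOn.circleIntegrable hε.le fun z hz => ?_
      have hz' := Metric.sphere_subset_closedBall hz
      exact (((hg ν hν z hz').mul (differentiableAt_inv_apply A (hsep ν hν z hz' (hne hz)) i j)
        ).mul_const _).continuousAt.continuousWithinAt
  have hpi : (2 * Real.pi * Complex.I : ℂ) ≠ 0 := Complex.two_pi_I_ne_zero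
  have hexp : (contourFunction g A ε).mulVec w i = (2 * Real.pi * Complex.I)⁻¹ *
      ∑ ν ∈ A.finite_spectrum.toFinset,
        ∑ j, (∮ z in C(ν, ε), g z * (z • (1 : Matrix (Fin n) (Fin n) ℂ) - A)⁻¹ i j) * w j := by
    simp only [Matrix.mulVec, dotProduct, contourFunction, Matrix.of_apply]
    rw [Finset.sum_comm]
    simp only [mul_assoc, ← Finset.mul_sum, Finset.sum_mul]
  rw [hexp, Finset.sum_congr rfl fun ν hν => hcircle ν (by simpa using hν), Finset.sum_comm,
    Finset.mul_sum, Finset.sum_apply]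
  refine Finset.sum_congr rfl fun k _ => ?_
  rw [← Finset.sum_mul, Finset.sum_congr rfl fun ν hν => hterm ν (by simpa using hν) k,
    Finset.sum_ite_eq' _ _ _, if_pos (by simpa using hμ), Pi.smul_apply, smul_eq_mul]
  field_simp

theorem matrixFunction_mulVec_of_genEigenvector {n : ℕ} {g : ℂ → ℂ}
    {A : Matrix (Fin n) (Fin n) ℂ} (hg : ∀ ν ∈ spectrum ℂ A, AnalyticAt ℂ g ν)
    {μ : ℂ} (hμ : μ ∈ spectrum ℂ A) {K : ℕ} {w : Fin n → ℂ}
    (hw : ((A - μ • (1 : Matrix (Fin n) (Fin n) ℂ)) ^ K).mulVec w = 0) :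
    (matrixFunction g A).mulVec w =
      ∑ k ∈ Finset.range K, (iteratedDeriv k g μ / k.factorial) •
        ((A - μ • (1 : Matrix (Fin n) (Fin n) ℂ)) ^ k).mulVec w := by
  have hloc : ∀ ν ∈ A.finite_spectrum.toFinset, ∀ᶠ δ in 𝓝[>] (0 : ℝ),
      ∀ z ∈ Metric.closedBall ν δ, DifferentiableAt ℂ g z ∧ (z ≠ ν → z ∉ spectrum ℂ A) := by
    intro ν hν
    have h1 : ∀ᶠ z in 𝓝 ν, DifferentiableAt ℂ g z :=
      (hg ν (by simpa using hν)).eventually_analyticAt.mono fun z hz => hz.differentiableAt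
    have h2 : ∀ᶠ z in 𝓝 ν, z ≠ ν → z ∉ spectrum ℂ A := by
      have hc : IsClosed (spectrum ℂ A \ {ν}) :=
        (A.finite_spectrum.subset Set.sdiff_subset).isClosed
      filter_upwards [hc.isOpen_compl.mem_nhds (x := ν) (by simp)] with z hz hzν hzA
      exact hz ⟨hzA, hzν⟩
    obtain ⟨r, hr, hball⟩ := Metric.eventually_nhds_iff_ball.1 (h1.and h2)
    filter_upwards [Ioo_mem_nhdsGT hr] with δ hδ z hz
    exact hball z (Metric.closedBall_subset_ball hδ.2 hz)
  have hall := (A.finite_spectrum.toFinset.eventually_all).2 hloc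
  obtain ⟨δ, ⟨hδ, hδ0⟩, heq⟩ :=
    ((hall.and self_mem_nhdsWithin).and (contourFunction_eventually_eq g A hg)).exists
  rw [← heq]
  exact contourFunction_mulVec_of_genEigenvector g A hδ0
    (fun ν hν z hz => (hδ ν (by simpa using hν) z hz).1)
    (fun ν hν z hz => (hδ ν (by simpa using hν) z hz).2) hμ hw

/-! ### Algebraic rules of the functional calculus. -/

/-- A property of vectors that is closed under addition holds for all vectors as soon as it holds
for the generalized eigenvectors of a matrix. -/
theorem Matrix.genEigenvector_induction {n : ℕ} (A : Matrix (Fin n) (Fin n) ℂ)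
    {P : (Fin n → ℂ) → Prop} (zero : P 0) (add : ∀ x y, P x → P y → P (x + y))
    (gen : ∀ μ ∈ spectrum ℂ A, ∀ (K : ℕ) (w : Fin n → ℂ),
      ((A - μ • (1 : Matrix (Fin n) (Fin n) ℂ)) ^ K).mulVec w = 0 → P w) (w : Fin n → ℂ) : P w := by
  have hw : w ∈ ⨆ μ, Module.End.maxGenEigenspace (Matrix.toLin' A) μ := by
    rw [Module.End.iSup_maxGenEigenspace_eq_top]
    trivial
  induction hw using Submodule.iSup_induction' with
  | mem μ x hx =>
    obtain ⟨K, hK⟩ := (Module.End.mem_maxGenEigenspace _ _ _).1 hx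
    have hlin : Matrix.toLin' A - μ • 1 =
        Matrix.toLin' (A - μ • (1 : Matrix (Fin n) (Fin n) ℂ)) := by
      simp [Module.End.one_eq_id]
    rw [hlin, ← Matrix.toLin'_pow, Matrix.toLin'_apply] at hK
    by_cases hμ : μ ∈ spectrum ℂ A
    · exact gen μ hμ K x hK
    -- Off the spectrum A − μ is invertible, so the generalized eigenspace is zero.
    · rw [spectrum.notMem_iff, Algebra.algebraMap_eq_smul_one, ← IsUnit.neg_iff, neg_sub] at hμ
      have hx0 : x = 0 := Matrix.mulVec_injective_of_isUnit (hμ.pow K) (by simpa using hK)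
      rwa [hx0]
  | zero => exact zero
  | add x y _ _ hx hy => exact add x y hx hy

theorem Matrix.ext_genEigenvector {n : ℕ} (A : Matrix (Fin n) (Fin n) ℂ)
    {P Q : Matrix (Fin n) (Fin n) ℂ}
    (h : ∀ μ ∈ spectrum ℂ A, ∀ (K : ℕ) (w : Fin n → ℂ),
      ((A - μ • (1 : Matrix (Fin n) (Fin n) ℂ)) ^ K).mulVec w = 0 → P.mulVec w = Q.mulVec w) :
    P = Q :=
  Matrix.ext_of_mulVec_single fun i => A.genEigenvector_induction (P := fun w => P.mulVec w = Q.mulVec w)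
    (by simp) (fun x y hx hy => by rw [Matrix.mulVec_add, Matrix.mulVec_add, hx, hy]) h _

/-- Only the Taylor coefficients at the eigenvalues enter. -/
theorem matrixFunction_congr {n : ℕ} {g h : ℂ → ℂ} {A : Matrix (Fin n) (Fin n) ℂ}
    (hg : ∀ ν ∈ spectrum ℂ A, AnalyticAt ℂ g ν) (hgh : ∀ ν ∈ spectrum ℂ A, g =ᶠ[𝓝 ν] h) :
    matrixFunction g A = matrixFunction h A := by
  have hh : ∀ ν ∈ spectrum ℂ A, AnalyticAt ℂ h ν := fun ν hν => (hg ν hν).congr (hgh ν hν)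
  refine A.ext_genEigenvector fun μ hμ K w hw => ?_
  rw [matrixFunction_mulVec_of_genEigenvector hg hμ hw,
    matrixFunction_mulVec_of_genEigenvector hh hμ hw]
  exact Finset.sum_congr rfl fun k _ => by rw [(hgh μ hμ).iteratedDeriv_eq k]

theorem matrixFunction_add {n : ℕ} {g h : ℂ → ℂ} {A : Matrix (Fin n) (Fin n) ℂ}
    (hg : ∀ ν ∈ spectrum ℂ A, AnalyticAt ℂ g ν) (hh : ∀ ν ∈ spectrum ℂ A, AnalyticAt ℂ h ν) :
    matrixFunction (g + h) A = matrixFunction g A + matrixFunction h A := by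
  refine A.ext_genEigenvector fun μ hμ K w hw => ?_
  rw [Matrix.add_mulVec, matrixFunction_mulVec_of_genEigenvector hg hμ hw,
    matrixFunction_mulVec_of_genEigenvector hh hμ hw,
    matrixFunction_mulVec_of_genEigenvector (fun ν hν => (hg ν hν).add (hh ν hν)) hμ hw,
    ← Finset.sum_add_distrib]
  refine Finset.sum_congr rfl fun k _ => ?_
  rw [iteratedDeriv_add (hg μ hμ).contDiffAt (hh μ hμ).contDiffAt, add_div, add_smul]

theorem matrixFunction_const_mul {n : ℕ} (c : ℂ) {g : ℂ → ℂ} {A : Matrix (Fin n) (Fin n) ℂ}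
    (hg : ∀ ν ∈ spectrum ℂ A, AnalyticAt ℂ g ν) :
    matrixFunction (fun z => c * g z) A = c • matrixFunction g A := by
  refine A.ext_genEigenvector fun μ hμ K w hw => ?_
  rw [Matrix.smul_mulVec, matrixFunction_mulVec_of_genEigenvector hg hμ hw,
    matrixFunction_mulVec_of_genEigenvector (fun ν hν => analyticAt_const.fun_mul (hg ν hν)) hμ hw,
    Finset.smul_sum]
  refine Finset.sum_congr rfl fun k _ => ?_
  rw [iteratedDeriv_const_mul_field, smul_smul, mul_div_assoc]

theorem matrixFunction_sub {n : ℕ} {g h : ℂ → ℂ} {A : Matrix (Fin n) (Fin n) ℂ}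
    (hg : ∀ ν ∈ spectrum ℂ A, AnalyticAt ℂ g ν) (hh : ∀ ν ∈ spectrum ℂ A, AnalyticAt ℂ h ν) :
    matrixFunction (g - h) A = matrixFunction g A - matrixFunction h A := by
  rw [eq_sub_iff_add_eq,
    ← matrixFunction_add (fun ν hν => (hg ν hν).sub (hh ν hν)) hh, sub_add_cancel]

theorem iteratedDeriv_succ_id_mul {g : ℂ → ℂ} {x : ℂ} (hg : AnalyticAt ℂ g x) (k : ℕ) :
    iteratedDeriv (k + 1) (fun z => z * g z) x =
      x * iteratedDeriv (k + 1) g x + (k + 1) * iteratedDeriv k g x := by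
  have := iteratedDeriv_mul (n := k + 1) (f := fun z : ℂ => z) (g := g) (x := x)
    contDiffAt_id hg.contDiffAt
  change iteratedDeriv (k + 1) ((fun z : ℂ => z) * g) x = _
  rw [this, Finset.sum_range_succ', Finset.sum_range_succ', Finset.sum_eq_zero]
  · have h1 : iteratedDeriv 1 (fun z : ℂ => z) x = 1 := by
      rw [iteratedDeriv_one, deriv_id'']
    simp [h1, add_comm]
  · intro i _
    have : iteratedDeriv (i + 1 + 1) (fun z : ℂ => z) x = 0 := by
      simpa using! iteratedDeriv_id (𝕜 := ℂ) (n := i + 1 + 1) (x := x)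
    rw [this]
    ring

theorem matrixFunction_id_mul {n : ℕ} {g : ℂ → ℂ} {A : Matrix (Fin n) (Fin n) ℂ}
    (hg : ∀ ν ∈ spectrum ℂ A, AnalyticAt ℂ g ν) :
    matrixFunction (fun z => z * g z) A = A * matrixFunction g A := by
  refine A.ext_genEigenvector fun μ hμ K w hw => ?_
  -- Multiplication by D shifts the index by one, so K terms under D are matched with K + 1 terms
  -- elsewhere.
  have hw' : ((A - μ • (1 : Matrix (Fin n) (Fin n) ℂ)) ^ (K + 1)).mulVec w = 0 := by
    rw [pow_succ', ← Matrix.mulVec_mulVec, hw, Matrix.mulVec_zero]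
  set D := A - μ • (1 : Matrix (Fin n) (Fin n) ℂ) with hD
  have hA : A = μ • 1 + D := by rw [hD]; abel
  have hD1 : ∀ x, A.mulVec x = μ • x + D.mulVec x := fun x => by
    conv_lhs => rw [hA]
    rw [Matrix.add_mulVec, Matrix.smul_mulVec, Matrix.one_mulVec]
  rw [← Matrix.mulVec_mulVec, hD1,
    matrixFunction_mulVec_of_genEigenvector (g := fun z => z * g z)
      (fun ν hν => analyticAt_id.fun_mul (hg ν hν)) hμ hw']
  conv_rhs =>
    arg 1
    rw [matrixFunction_mulVec_of_genEigenvector hg hμ hw']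
  rw [matrixFunction_mulVec_of_genEigenvector hg hμ hw, Finset.sum_range_succ',
    Finset.sum_range_succ', smul_add, Finset.smul_sum, Matrix.mulVec_sum, add_right_comm,
    ← Finset.sum_add_distrib]
  congr 1
  · refine Finset.sum_congr rfl fun k _ => ?_
    rw [iteratedDeriv_succ_id_mul (hg μ hμ), ← hD, Matrix.mulVec_smul, Matrix.mulVec_mulVec,
      ← pow_succ', smul_smul, ← add_smul]
    congr 1
    have hk : ((k : ℂ) + 1) ≠ 0 := by exact_mod_cast k.succ_ne_zero
    have hk' : (k.factorial : ℂ) ≠ 0 := by exact_mod_cast k.factorial_ne_zero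
    rw [Nat.factorial_succ]
    push_cast
    field_simp
  · simp [smul_smul]

theorem Polynomial.analyticAt_eval (p : ℂ[X]) (z : ℂ) : AnalyticAt ℂ (fun z => p.eval z) z := by
  simpa using AnalyticAt.aeval_polynomial (analyticAt_id (𝕜 := ℂ) (z := z)) p

theorem matrixFunction_eval_mul {n : ℕ} (p : ℂ[X]) {g : ℂ → ℂ} {A : Matrix (Fin n) (Fin n) ℂ}
    (hg : ∀ ν ∈ spectrum ℂ A, AnalyticAt ℂ g ν) :
    matrixFunction (fun z => p.eval z * g z) A = aeval A p * matrixFunction g A := by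
  induction p using Polynomial.induction_on with
  | C a => simp [matrixFunction_const_mul a hg, Algebra.algebraMap_eq_smul_one]
  | add p q hp hq =>
    rw [map_add, add_mul, ← hp, ← hq, ← matrixFunction_add
      (fun ν hν => (p.analyticAt_eval ν).fun_mul (hg ν hν))
      (fun ν hν => (q.analyticAt_eval ν).fun_mul (hg ν hν))]
    congr 1
    funext z
    simp [add_mul]
  | monomial k a h =>
    have hX : C a * X ^ (k + 1) = X * (C a * X ^ k : ℂ[X]) := by ring
    rw [hX, map_mul, aeval_X, mul_assoc, ← h,
      ← matrixFunction_id_mul (fun ν hν => ((C a * X ^ k : ℂ[X]).analyticAt_eval ν).fun_mul (hg ν hν))]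
    congr 1
    funext z
    rw [eval_mul, eval_X, mul_assoc]

/-! ### Differentiation along the segment from z₀ to A. -/

/-- The affine homotopy `(1 - t) z₀ 1 + t A` from `z₀ 1` to `A`. -/
def segmentMatrix {n : ℕ} (z₀ : ℂ) (A : Matrix (Fin n) (Fin n) ℂ) (t : ℝ) :
    Matrix (Fin n) (Fin n) ℂ :=
  (1 - (t : ℂ)) • (z₀ • (1 : Matrix (Fin n) (Fin n) ℂ)) + (t : ℂ) • A

theorem spectrum_segmentMatrix {n : ℕ} (z₀ : ℂ) (A : Matrix (Fin n) (Fin n) ℂ) (t : ℝ) :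
    spectrum ℂ (segmentMatrix z₀ A t) =
      (fun μ => (1 - (t : ℂ)) * z₀ + t * μ) '' spectrum ℂ A := by
  rcases n.eq_zero_or_pos with rfl | hn
  · simp
  · have : Nonempty (Fin n) := ⟨⟨0, hn⟩⟩
    have hB : segmentMatrix z₀ A t =
        aeval A (C ((1 - (t : ℂ)) * z₀) + C (t : ℂ) * X) := by
      rw [map_add, map_mul (aeval A), aeval_C, aeval_C, aeval_X, segmentMatrix,
        Algebra.algebraMap_eq_smul_one, Algebra.algebraMap_eq_smul_one, smul_smul,
        smul_one_mul]
    -- The nonempty-spectrum form of spectral mapping also covers t = 0, where the polynomial is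
    -- constant.
    rw [hB, spectrum.map_polynomial_aeval_of_nonempty A _
      (spectrum.nonempty_of_isAlgClosed_of_finiteDimensional ℂ A)]
    simp

/-- Since B(t) − ((1 − t)z₀ + tμ) = t(A − μ), generalized eigenvectors of A serve for every t, and
only scalar coefficients depend on t. -/
theorem matrixFunction_segmentMatrix_mulVec {n : ℕ} {g : ℂ → ℂ} {z₀ : ℂ}
    {A : Matrix (Fin n) (Fin n) ℂ} {t : ℝ}
    (hg : ∀ ν ∈ spectrum ℂ A, AnalyticAt ℂ g ((1 - (t : ℂ)) * z₀ + t * ν))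
    {μ : ℂ} (hμ : μ ∈ spectrum ℂ A) {K : ℕ} {w : Fin n → ℂ}
    (hw : ((A - μ • (1 : Matrix (Fin n) (Fin n) ℂ)) ^ K).mulVec w = 0) :
    (matrixFunction g (segmentMatrix z₀ A t)).mulVec w =
      ∑ k ∈ Finset.range K,
        ((t : ℂ) ^ k * iteratedDeriv k g ((1 - (t : ℂ)) * z₀ + t * μ) / k.factorial) •
          ((A - μ • (1 : Matrix (Fin n) (Fin n) ℂ)) ^ k).mulVec w := by
  have hB : segmentMatrix z₀ A t - ((1 - (t : ℂ)) * z₀ + t * μ) • 1 =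
      (t : ℂ) • (A - μ • (1 : Matrix (Fin n) (Fin n) ℂ)) := by
    rw [segmentMatrix, add_smul, smul_sub, smul_smul, smul_smul]
    abel
  rw [matrixFunction_mulVec_of_genEigenvector (K := K) (μ := (1 - (t : ℂ)) * z₀ + t * μ)]
  · refine Finset.sum_congr rfl fun k _ => ?_
    rw [hB, _root_.smul_pow, Matrix.smul_mulVec, smul_smul]
    congr 1
    ring
  · rw [spectrum_segmentMatrix]
    rintro _ ⟨ν, hν, rfl⟩
    exact hg ν hν
  · rw [spectrum_segmentMatrix]
    exact ⟨μ, hμ, rfl⟩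
  · rw [hB, _root_.smul_pow, Matrix.smul_mulVec, hw, smul_zero]

theorem hasDerivAt_matrixFunction_segmentMatrix_mulVec {n : ℕ} {g : ℂ → ℂ} {z₀ : ℂ}
    {A : Matrix (Fin n) (Fin n) ℂ} {t : ℝ}
    (hg : ∀ ν ∈ spectrum ℂ A, AnalyticAt ℂ g ((1 - (t : ℂ)) * z₀ + t * ν)) (w : Fin n → ℂ) :
    HasDerivAt (fun s : ℝ => (matrixFunction g (segmentMatrix z₀ A s)).mulVec w)
      (((A - z₀ • (1 : Matrix (Fin n) (Fin n) ℂ)) *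
        matrixFunction (deriv g) (segmentMatrix z₀ A t)).mulVec w) t := by
  induction w using A.genEigenvector_induction with
  | zero => simpa using hasDerivAt_const t (0 : Fin n → ℂ)
  | add x y hx hy =>
    simp only [Matrix.mulVec_add]
    exact hx.add hy
  | gen μ hμ K w hw =>
    have hw' : ((A - μ • (1 : Matrix (Fin n) (Fin n) ℂ)) ^ (K + 1)).mulVec w = 0 := by
      rw [pow_succ', ← Matrix.mulVec_mulVec, hw, Matrix.mulVec_zero]
    have hline : ∀ ν : ℂ, HasDerivAt (fun s : ℝ => (1 - (s : ℂ)) * z₀ + s * ν) (ν - z₀) t := by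
      intro ν
      have h1 : HasDerivAt (fun s : ℝ => (s : ℂ)) 1 t := Complex.ofRealCLM.hasDerivAt
      have := ((h1.const_sub 1).mul_const z₀).add (h1.mul_const ν)
      exact this.congr_deriv (by ring)
    have hev : ∀ᶠ s : ℝ in 𝓝 t, ∀ ν ∈ spectrum ℂ A,
        AnalyticAt ℂ g ((1 - (s : ℂ)) * z₀ + s * ν) := by
      rw [A.finite_spectrum.eventually_all]
      intro ν hν
      exact (hline ν).continuousAt.eventually (hg ν hν).eventually_analyticAt
    have hg' : ∀ ν ∈ spectrum ℂ A, AnalyticAt ℂ (deriv g) ((1 - (t : ℂ)) * z₀ + t * ν) :=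
      fun ν hν => (hg ν hν).deriv
    set D := A - μ • (1 : Matrix (Fin n) (Fin n) ℂ) with hD
    have hA : A - z₀ • (1 : Matrix (Fin n) (Fin n) ℂ) = (μ - z₀) • 1 + D := by
      rw [hD, sub_smul]; abel
    -- At k = 0 the truncated exponent k - 1 is harmless because of the factor k.
    have hcoef : ∀ k : ℕ, HasDerivAt
        (fun s : ℝ => (s : ℂ) ^ k * iteratedDeriv k g ((1 - (s : ℂ)) * z₀ + s * μ) / k.factorial)
        ((k * (t : ℂ) ^ (k - 1) * iteratedDeriv k g ((1 - (t : ℂ)) * z₀ + t * μ) +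
          (t : ℂ) ^ k * (iteratedDeriv (k + 1) g ((1 - (t : ℂ)) * z₀ + t * μ) * (μ - z₀))) /
            k.factorial) t := by
      intro k
      have h1 : HasDerivAt (fun s : ℝ => (s : ℂ)) 1 t := Complex.ofRealCLM.hasDerivAt
      have h2 : HasDerivAt (iteratedDeriv k g)
          (iteratedDeriv (k + 1) g ((1 - (t : ℂ)) * z₀ + t * μ)) ((1 - (t : ℂ)) * z₀ + t * μ) := by
        rw [iteratedDeriv_succ, hasDerivAt_deriv_iff, iteratedDeriv_eq_iterate]
        exact ((hg μ hμ).iterated_deriv k).differentiableAt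
      have := ((h1.pow k).mul (h2.comp t (hline μ))).div_const (k.factorial : ℂ)
      simpa using this
    have hsum : HasDerivAt (fun s : ℝ => ∑ k ∈ Finset.range (K + 1),
        ((s : ℂ) ^ k * iteratedDeriv k g ((1 - (s : ℂ)) * z₀ + s * μ) / k.factorial) •
          (D ^ k).mulVec w) _ t :=
      HasDerivAt.fun_sum fun k _ => (hcoef k).smul_const _
    refine (hsum.congr_of_eventuallyEq
      (hev.mono fun s hs => matrixFunction_segmentMatrix_mulVec hs hμ hw')).congr_deriv ?_
    -- With A − z₀ = (μ − z₀) + D, the terms from differentiating g^(k) give the scalar part, and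
    -- those from differentiating t^k, shifted by one, give the D part.
    rw [← Matrix.mulVec_mulVec, hA, Matrix.add_mulVec, Matrix.smul_mulVec, Matrix.one_mulVec]
    conv_rhs =>
      arg 1
      rw [matrixFunction_segmentMatrix_mulVec hg' hμ hw']
    rw [matrixFunction_segmentMatrix_mulVec hg' hμ hw, Finset.sum_range_succ',
      Finset.sum_range_succ', smul_add, Finset.smul_sum, Matrix.mulVec_sum, add_right_comm,
      ← Finset.sum_add_distrib]
    congr 1
    · refine Finset.sum_congr rfl fun k _ => ?_
      rw [← hD, Matrix.mulVec_smul, Matrix.mulVec_mulVec,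
        ← pow_succ', smul_smul, ← add_smul, ← iteratedDeriv_succ', ← iteratedDeriv_succ']
      congr 1
      have hk : ((k : ℂ) + 1) ≠ 0 := by exact_mod_cast k.succ_ne_zero
      have hk' : (k.factorial : ℂ) ≠ 0 := by exact_mod_cast k.factorial_ne_zero
      rw [Nat.factorial_succ]
      push_cast
      field_simp
      ring
    · rw [smul_smul, ← iteratedDeriv_succ']
      simp [mul_comm]

/-! ### Norm estimates and derivatives in an arbitrary norm. -/

/-- Integrating the bound on F_N repeatedly, from zero initial values, gains one power of t and one
factor of the factorial each time; k counts downwards from N. -/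
theorem norm_le_pow_div_factorial_of_hasDerivAt {E : Type*} [NormedAddCommGroup E]
    [NormedSpace ℝ E] {F : ℕ → ℝ → E} {N : ℕ} {c : ℝ}
    (hF : ∀ j < N, ∀ t ∈ Set.Icc (0 : ℝ) 1, HasDerivAt (F j) (F (j + 1) t) t)
    (h0 : ∀ j < N, F j 0 = 0) (hc : ∀ t ∈ Set.Icc (0 : ℝ) 1, ‖F N t‖ ≤ c) :
    ∀ k ≤ N, ∀ t ∈ Set.Icc (0 : ℝ) 1, ‖F (N - k) t‖ ≤ c * (t ^ k / k.factorial) := by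
  intro k
  induction k with
  | zero => simpa using hc
  | succ k ih =>
    intro hk
    have hlt : N - (k + 1) < N := by omega
    have hsucc : N - (k + 1) + 1 = N - k := by omega
    have hder : ∀ t ∈ Set.Icc (0 : ℝ) 1, HasDerivAt (F (N - (k + 1))) (F (N - k) t) t := by
      intro t ht
      have := hF _ hlt t ht
      rwa [hsucc] at this
    have hB : ∀ t : ℝ, HasDerivAt (fun t : ℝ => c * (t ^ (k + 1) / (k + 1).factorial))
        (c * (t ^ k / k.factorial)) t := by
      intro t
      refine (((hasDerivAt_pow (k + 1) t).div_const _).const_mul c).congr_deriv ?_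
      have hk' : (k.factorial : ℝ) ≠ 0 := by exact_mod_cast k.factorial_ne_zero
      have hk1 : ((k : ℝ) + 1) ≠ 0 := by exact_mod_cast k.succ_ne_zero
      rw [Nat.factorial_succ]
      push_cast
      field_simp
    refine fun t ht => image_norm_le_of_norm_deriv_right_le_deriv_boundary
      (fun s hs => (hder s hs).continuousAt.continuousWithinAt)
      (fun s hs => (hder s (Set.Ico_subset_Icc_self hs)).hasDerivWithinAt) ?_ hB
      (fun s hs => ih (by omega) s (Set.Ico_subset_Icc_self hs)) ht
    simp [h0 _ hlt]

/-- A separate normed space E carries the given norm, so it does not compete with the entrywise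
topology on matrices. -/
theorem Seminorm.exists_linearMap_norm_eq {V : Type} [AddCommGroup V] [Module ℂ V]
    (p : Seminorm ℂ V) (hp : ∀ x, p x = 0 → x = 0) :
    ∃ (E : Type) (_ : NormedAddCommGroup E) (_ : NormedSpace ℂ E) (e : V →ₗ[ℂ] E),
      ∀ x, ‖e x‖ = p x := by
  let q : AddGroupNorm V :=
    { p.toAddGroupSeminorm with eq_zero_of_map_eq_zero' := hp }
  let := q.toNormedAddCommGroup
  exact ⟨V, inferInstance, { norm_smul_le := fun a x => (map_smul_eq_mul p a x).le },
    LinearMap.id, fun _ => rfl⟩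

/-- Passes from derivatives tested on vectors to derivatives in the given norm: e is a finite
combination of the entries, and these are read off on basis vectors. -/
theorem Matrix.hasDerivAt_linearMap {n : ℕ} {E : Type*} [NormedAddCommGroup E] [NormedSpace ℂ E]
    (e : Matrix (Fin n) (Fin n) ℂ →ₗ[ℂ] E) {P : ℝ → Matrix (Fin n) (Fin n) ℂ}
    {P' : Matrix (Fin n) (Fin n) ℂ} {t : ℝ}
    (hP : ∀ w, HasDerivAt (fun s => (P s).mulVec w) (P'.mulVec w) t) :
    HasDerivAt (fun s => e (P s)) (e P') t := by
  have hsum : ∀ Q : Matrix (Fin n) (Fin n) ℂ,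
      e Q = ∑ a, ∑ b, Q a b • e (Matrix.single a b 1) := by
    intro Q
    conv_lhs => rw [Matrix.matrix_eq_sum_single Q]
    simp only [map_sum, ← map_smul, Matrix.smul_single, smul_eq_mul, mul_one]
  have hentry : ∀ a b, HasDerivAt (fun s => P s a b) (P' a b) t := by
    intro a b
    have := hasDerivAt_pi.1 (hP (Pi.single b 1)) a
    simpa using this
  rw [funext fun s => hsum (P s), hsum P']
  exact HasDerivAt.fun_sum fun a _ => HasDerivAt.fun_sum fun b _ => (hentry a b).smul_const _

/-! ### The Padé error and the final bound. -/

theorem isUnit_aeval_of_eval_ne_zero {n : ℕ} {A : Matrix (Fin n) (Fin n) ℂ} {p : ℂ[X]}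
    (hp : ∀ μ ∈ spectrum ℂ A, p.eval μ ≠ 0) : IsUnit (aeval A p) := by
  rcases n.eq_zero_or_pos with rfl | hn
  · exact isUnit_of_subsingleton _
  · have : Nonempty (Fin n) := ⟨⟨0, hn⟩⟩
    rw [← spectrum.zero_notMem_iff ℂ, spectrum.map_polynomial_aeval_of_nonempty A _
      (spectrum.nonempty_of_isAlgClosed_of_finiteDimensional ℂ A)]
    rintro ⟨μ, hμ, h⟩
    exact hp μ hμ h

theorem Polynomial.iteratedDeriv_eval (p : ℂ[X]) (k : ℕ) :
    iteratedDeriv k (fun z => p.eval z) = fun z => (derivative^[k] p).eval z := by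
  induction k with
  | zero => simp
  | succ k ih =>
    rw [iteratedDeriv_succ, ih, Function.iterate_succ_apply']
    funext z
    exact Polynomial.deriv _

/-- The numerator `v f - u` of the Padé error vanishes at `z₀` to order `L + M + 1`. -/
theorem IsPadeApproximant.iteratedDeriv_eq_zero {f : ℂ → ℂ} {z₀ : ℂ} {L M : ℕ} {u v : ℂ[X]}
    (hr : IsPadeApproximant f z₀ L M u v) (hf : AnalyticAt ℂ f z₀) {j : ℕ} (hj : j < L + M + 1) :
    iteratedDeriv j (fun z => v.eval z * f z - u.eval z) z₀ = 0 := by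
  have hrat : AnalyticAt ℂ (fun z => u.eval z / v.eval z) z₀ :=
    (u.analyticAt_eval z₀).fun_div (v.analyticAt_eval z₀) hr.den_ne_zero
  have hsub : AnalyticAt ℂ (f - fun z => u.eval z / v.eval z) z₀ := hf.sub hrat
  have hne : ∀ᶠ z in 𝓝 z₀, v.eval z ≠ 0 :=
    (v.analyticAt_eval z₀).continuousAt.eventually_ne hr.den_ne_zero
  -- Near z₀ the numerator is v(f − r), and Leibniz leaves only terms containing a vanishing
  -- derivative of f − r.
  have heq : (fun z => v.eval z * f z - u.eval z) =ᶠ[𝓝 z₀]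
      (fun z => v.eval z) * (f - fun z => u.eval z / v.eval z) := by
    filter_upwards [hne] with z hz
    simp only [Pi.mul_apply, Pi.sub_apply]
    field_simp
  have hz : ∀ i < L + M + 1, iteratedDeriv i (f - fun z => u.eval z / v.eval z) z₀ = 0 := by
    intro i hi
    rw [iteratedDeriv_sub hf.contDiffAt hrat.contDiffAt, hr.interpolates i hi, sub_self]
  rw [heq.iteratedDeriv_eq, iteratedDeriv_mul (v.analyticAt_eval z₀).contDiffAt hsub.contDiffAt]
  refine Finset.sum_eq_zero fun i _ => ?_
  rw [hz (j - i) (by omega), mul_zero]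

theorem matrixFunction_segmentMatrix_zero {n : ℕ} {g : ℂ → ℂ} {z₀ : ℂ}
    {A : Matrix (Fin n) (Fin n) ℂ} (hg : AnalyticAt ℂ g z₀) (h0 : g z₀ = 0) :
    matrixFunction g (segmentMatrix z₀ A 0) = 0 := by
  refine A.ext_genEigenvector fun μ hμ K w hw => ?_
  rw [matrixFunction_segmentMatrix_mulVec (by simpa using fun _ _ => hg) hμ hw, Matrix.zero_mulVec]
  refine Finset.sum_eq_zero fun k _ => ?_
  rcases k.eq_zero_or_pos with rfl | hk
  · simp [h0]
  · simp [hk.ne']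

theorem corollaryc {n : ℕ} (A : Matrix (Fin n) (Fin n) ℂ) (f : ℂ → ℂ) (z₀ : ℂ) (R : ℝ)
    (hR : 0 < R) (hf : AnalyticOnNhd ℂ f (Metric.ball z₀ R))
    (hA : spectrum ℂ A ⊆ Metric.ball z₀ R)
    (L M : ℕ) (u v : ℂ[X]) (hr : IsPadeApproximant f z₀ L M u v)
    (hv : ∀ μ ∈ spectrum ℂ A, v.eval μ ≠ 0)
    (nrm : Seminorm ℂ (Matrix (Fin n) (Fin n) ℂ)) (hnrm : ∀ B, nrm B = 0 → B = 0)
    (N : ℕ) (hN : N = L + M + 1) :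
    ∃ m : ℝ,
      IsGreatest
        ((fun t : ℝ =>
            nrm ((A - z₀ • (1 : Matrix (Fin n) (Fin n) ℂ)) ^ N * (aeval A v)⁻¹ *
              ((N.factorial : ℂ)⁻¹ •
                matrixFunction (iteratedDeriv N (fun z => v.eval z * f z))
                  ((1 - (t : ℂ)) • (z₀ • (1 : Matrix (Fin n) (Fin n) ℂ)) + (t : ℂ) • A)))) ''
          Set.Icc (0 : ℝ) 1) m ∧
      nrm (matrixFunction f A - matrixFunction (fun z => u.eval z / v.eval z) A) ≤ m := by
  obtain ⟨E, _, _, e, he⟩ := nrm.exists_linearMap_norm_eq hnrm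
  have hz₀ : z₀ ∈ Metric.ball z₀ R := Metric.mem_ball_self hR
  set G : ℂ → ℂ := fun z => v.eval z * f z - u.eval z with hG
  set D := A - z₀ • (1 : Matrix (Fin n) (Fin n) ℂ) with hD
  have hGan : AnalyticOnNhd ℂ G (Metric.ball z₀ R) := fun z hz =>
    ((v.analyticAt_eval z).fun_mul (hf z hz)).fun_sub (u.analyticAt_eval z)
  have hGj : ∀ j, AnalyticOnNhd ℂ (iteratedDeriv j G) (Metric.ball z₀ R) := fun j => by
    rw [iteratedDeriv_eq_iterate]
    exact hGan.iterated_deriv j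
  have hseg : ∀ t ∈ Set.Icc (0 : ℝ) 1, ∀ ν ∈ spectrum ℂ A,
      (1 - (t : ℂ)) * z₀ + t * ν ∈ Metric.ball z₀ R := by
    intro t ht ν hν
    have := (convex_ball z₀ R) hz₀ (hA hν) (sub_nonneg.2 ht.2) ht.1 (by ring)
    simpa using this
  have hGN : ∀ z ∈ Metric.ball z₀ R,
      iteratedDeriv N (fun z => v.eval z * f z) z = iteratedDeriv N G z := by
    intro z hz
    have hu : iteratedDeriv N (fun z => u.eval z) z = 0 := by
      rw [u.iteratedDeriv_eval, Polynomial.iterate_derivative_eq_zero]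
      · simp
      have := hr.natDegree_num_le
      omega
    have := iteratedDeriv_sub (n := N) ((v.analyticAt_eval z).fun_mul (hf z hz)).contDiffAt
      (u.analyticAt_eval z).contDiffAt
    rw [hu, sub_zero] at this
    exact this.symm
  have hmf : ∀ t ∈ Set.Icc (0 : ℝ) 1,
      matrixFunction (iteratedDeriv N (fun z => v.eval z * f z)) (segmentMatrix z₀ A t) =
        matrixFunction (iteratedDeriv N G) (segmentMatrix z₀ A t) := by
    intro t ht
    have hmem : ∀ ν ∈ spectrum ℂ (segmentMatrix z₀ A t), ν ∈ Metric.ball z₀ R := by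
      rw [spectrum_segmentMatrix]
      rintro _ ⟨ν, hν, rfl⟩
      exact hseg t ht ν hν
    refine (matrixFunction_congr (fun ν hν => hGj N ν (hmem ν hν)) fun ν hν => ?_).symm
    filter_upwards [Metric.isOpen_ball.mem_nhds (hmem ν hν)] with z hz using (hGN z hz).symm
  have hVunit := isUnit_aeval_of_eval_ne_zero hv
  -- Both factors come from polynomials in A. In F the inverse stands on the left, where it cancels
  -- v(A) at j = 0 and lets D^j absorb the D produced by differentiation.
  have hcomm : D ^ N * (aeval A v)⁻¹ = (aeval A v)⁻¹ * D ^ N := by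
    have h1 : D = aeval A (X - C z₀) := by simp [hD, Algebra.algebraMap_eq_smul_one]
    have h2 : D ^ N * aeval A v = aeval A v * D ^ N := by
      rw [h1, ← map_pow, ← map_mul, ← map_mul, mul_comm]
    have hdet := (Matrix.isUnit_iff_isUnit_det _).1 hVunit
    calc D ^ N * (aeval A v)⁻¹
        = (aeval A v)⁻¹ * (aeval A v * D ^ N) * (aeval A v)⁻¹ := by
          rw [← mul_assoc, Matrix.nonsing_inv_mul _ hdet, one_mul]
      _ = (aeval A v)⁻¹ * D ^ N := by
          rw [← h2, mul_assoc, mul_assoc, Matrix.mul_nonsing_inv _ hdet, mul_one]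
  set F : ℕ → ℝ → E := fun j t =>
    e ((aeval A v)⁻¹ * D ^ j * matrixFunction (iteratedDeriv j G) (segmentMatrix z₀ A t)) with hF
  have hFder : ∀ j, ∀ t ∈ Set.Icc (0 : ℝ) 1, HasDerivAt (F j) (F (j + 1) t) t := by
    intro j t ht
    have := Matrix.hasDerivAt_linearMap
      (e ∘ₗ LinearMap.mulLeft ℂ ((aeval A v)⁻¹ * D ^ j))
      (hasDerivAt_matrixFunction_segmentMatrix_mulVec
        fun ν hν => hGj j _ (hseg t ht ν hν))
    simp only [LinearMap.comp_apply, LinearMap.mulLeft_apply, ← iteratedDeriv_succ] at this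
    refine this.congr_deriv ?_
    simp only [hF, pow_succ, mul_assoc, ← hD]
  have hval : ∀ t ∈ Set.Icc (0 : ℝ) 1,
      nrm (D ^ N * (aeval A v)⁻¹ * ((N.factorial : ℂ)⁻¹ •
        matrixFunction (iteratedDeriv N (fun z => v.eval z * f z))
          (segmentMatrix z₀ A t))) = ‖F N t‖ / N.factorial := by
    intro t ht
    rw [hmf t ht, hcomm, Matrix.mul_smul, map_smul_eq_mul, hF, he]
    simp [div_eq_inv_mul]
  -- G is analytic, so F_N is itself differentiable; continuity on [0,1] makes the maximum attained.
  have hcont : ContinuousOn (fun t => ‖F N t‖ / N.factorial) (Set.Icc (0 : ℝ) 1) := fun t ht =>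
    ((hFder N t ht).continuousAt.norm.div_const _).continuousWithinAt
  obtain ⟨s, hs, hmax⟩ := isCompact_Icc.exists_isMaxOn ⟨0, by simp⟩ hcont
  have hfac : (0 : ℝ) < N.factorial := by exact_mod_cast N.factorial_pos
  refine ⟨‖F N s‖ / N.factorial, ⟨⟨s, hs, hval s hs⟩, ?_⟩, ?_⟩
  · rintro _ ⟨t, ht, rfl⟩
    exact (hval t ht).trans_le (hmax ht)
  · have hF0 : ∀ j < N, F j 0 = 0 := by
      intro j hj
      have := hr.iteratedDeriv_eq_zero (hf z₀ hz₀) (hN ▸ hj)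
      simp only [hF]
      rw [matrixFunction_segmentMatrix_zero (hGj j z₀ hz₀) this, mul_zero, map_zero]
    have hbound := norm_le_pow_div_factorial_of_hasDerivAt (N := N) (c := ‖F N s‖)
      (fun j _ => hFder j) hF0
      (fun t ht => (div_le_div_iff_of_pos_right hfac).1 (hmax ht)) N le_rfl 1 (by simp)
    have hF1 : F 0 1 = e (matrixFunction f A - matrixFunction (fun z => u.eval z / v.eval z) A) := by
      have hseg1 : segmentMatrix z₀ A 1 = A := by simp [segmentMatrix]
      have hfA : ∀ ν ∈ spectrum ℂ A, AnalyticAt ℂ f ν := fun ν hν => hf ν (hA hν)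
      have hrA : ∀ ν ∈ spectrum ℂ A, AnalyticAt ℂ (fun z => u.eval z / v.eval z) ν := fun ν hν =>
        (u.analyticAt_eval ν).fun_div (v.analyticAt_eval ν) (hv ν hν)
      have hGA : matrixFunction G A =
          aeval A v * (matrixFunction f A - matrixFunction (fun z => u.eval z / v.eval z) A) := by
        rw [← matrixFunction_sub hfA hrA,
          ← matrixFunction_eval_mul v fun ν hν => (hfA ν hν).sub (hrA ν hν)]
        -- G = v(f − r) may fail at zeros of v, but holds near each eigenvalue, which suffices.
        refine matrixFunction_congr (fun ν hν => hGan ν (hA hν)) fun ν hν => ?_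
        filter_upwards [(v.analyticAt_eval ν).continuousAt.eventually_ne (hv ν hν)] with z hz
        simp only [hG, Pi.sub_apply]
        field_simp
      simp only [hF, hseg1, iteratedDeriv_zero, pow_zero, mul_one]
      rw [hGA, ← mul_assoc, Matrix.nonsing_inv_mul _ ((Matrix.isUnit_iff_isUnit_det _).1 hVunit),
        one_mul]
    rw [← he, ← hF1]
    simpa [div_eq_mul_inv] using hbound
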